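/- A group is called quasisimple if it is perfect and its quotient by its center is simple. Let $n>2$ be an integer. Then for every $N$ there is a finite quasisimple group $G$ with $|G|>N$ such that the map $G\times G\to G$, $(x,y)\mapsto x^ny^n$, is not surjective. More precisely: (a) if $p$ is an odd prime dividing $n$, then there are infinitely many primes $q\equiv p+1 \pmod{p^2}$, and for every prime power $q\equiv p+1\pmod{p^2}$ the group $\mathrm{SL}_p(q)$ is quasisimple and $(x,y)\mapsto x^ny^n$ is not surjective on it; (b) if $4$ divides $n$, then there are infinitely many primes $q\equiv 3\pmod 8$, and for every prime power $q\equiv 3\pmod 8$ with $q>3$ the group $\mathrm{SL}_2(q)$ is quasisimple and $(x,y)\mapsto x^ny^n$ is not surjective on it. -/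

import Mathlib

/-- A group is quasisimple if it is perfect and its quotient by its center is simple.
(The simple quotient is then automatically non-abelian: a perfect group with cyclic central
quotient is abelian, hence trivial, and its quotient would not be simple.) -/
structure IsQuasisimpleGroup (G : Type*) [Group G] : Prop where
  isPerfect : Group.IsPerfect G
  isSimpleGroup_quotient_center : IsSimpleGroup (G ⧸ Subgroup.center G)

/-- The word map `(x, y) ↦ x ^ n * y ^ n` from `G × G` to `G`. -/
def powerWordMap (G : Type*) [Group G] (n : ℕ) : G × G → G :=
  fun g => g.1 ^ n * g.2 ^ n

/-! A central scalar `ζ` is missed. If `x ^ m * y ^ m = ζ` in `SL_k(q)` and `r ∣ m`, then suitable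
powers of `x` and `y⁻¹` have eigenvalues `a`, `b` with `a ^ r = ζ * b ^ r`. By
`pow_eq_one_of_isRoot_charpoly` each lies in an extension of degree `d < k`, or has norm one, so
order dividing `N = 1 + q + ⋯ + q ^ (k - 1)`. All `r`-th roots of `ζ` and `ζ⁻¹` have one order `M`
that fits neither kind, and `false_of_pow_eq_mul_pow` refutes every combination. Take `r = k = p`,
`ζ` of order `p`, `M = p ^ 2`; or `r = 4`, `k = 2`, `ζ = -1`, `M = 8`. Quasisimplicity comes from
perfectness and Iwasawa's criterion, and Dirichlet's theorem supplies the primes `q`. -/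

open Matrix Matrix.SpecialLinearGroup
open scoped MatrixGroups LinearAlgebra.Projectivization commutatorElement

/-! ### Generation by transvections and perfectness. -/

namespace Matrix.SpecialLinearGroup

section Field

variable {ι F : Type*} [Field F] [DecidableEq ι] [Fintype ι]

/-- Whitehead's identity `w(a) * w(-1)`, where `w(a)` is the product of the first three factors. -/
theorem diag2n_eq_mul_transvection {i j : ι} (hij : i ≠ j) (a : F) (ha : a ≠ 0) :
    diag2n hij a ha = transvection hij a * transvection hij.symm (-a⁻¹) * transvection hij a *
      transvection hij (-1) * transvection hij.symm 1 * transvection hij (-1) := by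
  have hdiag : (diag2n hij a ha : Matrix ι ι F) =
      1 + (a - 1) • single i i (1 : F) + (a⁻¹ - 1) • single j j (1 : F) := by
    ext k l
    simp only [diag2n_coe, diagonal_apply, add_apply, smul_apply, single_apply, one_apply,
      smul_eq_mul]
    grind
  apply Subtype.ext
  rw [hdiag]
  simp only [coe_mul, transvection_coe]
  have key (c : F) (k l : ι) : single k l c = c • single k l (1 : F) := by simp
  rw [key a, key (-a⁻¹), key (-1)]
  generalize ha' : a⁻¹ = b
  have hab : a * b = 1 := by rw [← ha', mul_inv_cancel₀ ha]
  have hb : b * a = 1 := by rw [mul_comm, hab]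
  simp only [mul_add, add_mul, one_mul, mul_one, smul_mul_assoc, mul_smul_comm,
    single_mul_single_same, single_mul_single_of_ne _ _ _ _ hij,
    single_mul_single_of_ne _ _ _ _ hij.symm, smul_zero, add_zero]
  ext k l
  simp only [add_apply, smul_apply, smul_eq_mul]
  grind

theorem transvection_induction [Nontrivial ι] (P : SpecialLinearGroup ι F → Prop)
    (htransvec : ∀ (i j : ι) (h : i ≠ j) (c : F), P (transvection h c))
    (hmul : ∀ A B, P A → P B → P (A * B)) (A : SpecialLinearGroup ι F) : P A := by
  refine diagonal_transvection_induction' P A (fun i j hij c hc ↦ ?_) htransvec hmul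
  rw [diag2n_eq_mul_transvection hij c hc]
  refine hmul _ _ (hmul _ _ (hmul _ _ (hmul _ _ (hmul _ _ ?_ ?_) ?_) ?_) ?_) ?_
  all_goals exact htransvec _ _ _ _

/-- The third index `k` is why perfectness is free of conditions on the field only in rank above
two. -/
theorem commutatorElement_transvection {i j k : ι} (hik : i ≠ k) (hkj : k ≠ j) (hij : i ≠ j)
    (c : F) : ⁅transvection hik c, transvection hkj (1 : F)⁆ = transvection hij c := by
  rw [commutatorElement_def, transvection_inv, transvection_inv]
  apply Subtype.ext
  simp only [coe_mul, transvection_coe]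
  simp [mul_add, add_mul, single_mul_single_of_ne, hij.symm, hik.symm, hkj.symm, ← single_neg]
  abel

theorem isPerfect_of_two_lt_card (h : 2 < Fintype.card ι) :
    Group.IsPerfect (SpecialLinearGroup ι F) := by
  have : Nontrivial ι := Fintype.one_lt_card_iff_nontrivial.1 (by omega)
  refine ⟨eq_top_iff.2 fun A _ ↦ transvection_induction (· ∈ commutator _) ?_
    (fun _ _ ↦ mul_mem) A⟩
  intro i j hij c
  obtain ⟨k, hk⟩ : ∃ k, k ∉ ({i, j} : Finset ι) := by
    by_contra! hall
    have := Finset.card_le_card (fun x _ ↦ hall x : (Finset.univ : Finset ι) ⊆ {i, j})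
    have := Finset.card_le_two (a := i) (b := j)
    simp only [Finset.card_univ] at *
    omega
  simp only [Finset.mem_insert, Finset.mem_singleton, not_or] at hk
  rw [← commutatorElement_transvection (Ne.symm hk.1) hk.2 hij]
  exact Subgroup.commutator_mem_commutator (Subgroup.mem_top _) (Subgroup.mem_top _)

theorem iSup_lineStab_eq_top [Nontrivial ι] :
    (⨆ p : ℙ F (ι → F), lineStab p.submodule) = (⊤ : Subgroup (SpecialLinearGroup ι F)) := by
  refine eq_top_iff.2 fun A _ ↦ transvection_induction (· ∈ _) ?_ (fun _ _ ↦ mul_mem) A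
  intro i j hij c
  have hi : (Pi.single i 1 : ι → F) ≠ 0 := Pi.single_ne_zero_iff.2 one_ne_zero
  refine Subgroup.mem_iSup_of_mem (Projectivization.mk F _ hi) ?_
  rw [Projectivization.submodule_mk]
  exact SL2Gen.transvection_mem_lineStab hij c

end Field

end Matrix.SpecialLinearGroup

/-! ### Simplicity of `PSL` by Iwasawa's criterion. -/

namespace Matrix.ProjectiveSpecialLinearGroup

variable {ι F : Type*} [Field F] [DecidableEq ι] [Fintype ι]

/-- The Iwasawa structure of the action of `PSL` on projective space. -/
noncomputable def iwasawaStructure [Nontrivial ι] :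
    MulAction.IwasawaStructure (ProjectiveSpecialLinearGroup ι F) (ℙ F (ι → F)) where
  T := PSL.iwasawaT
  is_comm p := by
    have hSL : IsMulCommutative (lineStab (F := F) (ι := ι) p.submodule) := by
      rw [← Projectivization.mk_rep p, Projectivization.submodule_mk]
      exact lineStab_isMulCommutative_of_span p.rep p.rep_nonzero
    exact Subgroup.map_isMulCommutative _ _
  is_conj g p := by
    obtain ⟨g, rfl⟩ := QuotientGroup.mk_surjective g
    rw [smul_proj_mk]
    change Subgroup.map _ _ = _
    rw [PSL.smul_submodule, lineStab_smul, PSL.iwasawaT_map_conj]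
  is_generator := by
    change ⨆ p, Subgroup.map _ _ = _
    rw [← Subgroup.map_iSup, iSup_lineStab_eq_top]
    exact Subgroup.map_top_of_surjective _ (QuotientGroup.mk'_surjective _)

theorem isSimpleGroup_of_isPerfect [Nontrivial ι]
    (h : Group.IsPerfect (SpecialLinearGroup ι F)) :
    IsSimpleGroup (ProjectiveSpecialLinearGroup ι F) := by
  have : Group.IsPerfect (ProjectiveSpecialLinearGroup ι F) := inferInstance
  exact iwasawaStructure.isSimpleGroup this.commutator_eq_top inferInstance

end Matrix.ProjectiveSpecialLinearGroup
open Polynomial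

/-! ### The eigenvalue obstruction. -/

namespace Matrix.SpecialLinearGroup

section Eigenvalues

variable {F K : Type*} [Field F] [Field K] [Algebra F K]

/-- An eigenvalue of a matrix of determinant one over a finite field with `q` elements either has
degree `d < n`, or has norm one. -/
theorem pow_eq_one_of_isRoot_charpoly [Finite F] {ι : Type*} [Fintype ι] [DecidableEq ι]
    [Nonempty ι] (X : SpecialLinearGroup ι F) {a : K} (ha : aeval a (X : Matrix ι ι F).charpoly = 0) :
    (∃ d, 0 < d ∧ d < Fintype.card ι ∧ a ^ (Nat.card F ^ d - 1) = 1) ∨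
      a ^ (∑ i ∈ Finset.range (Fintype.card ι), Nat.card F ^ i) = 1 := by
  have hint : IsIntegral F a := ⟨_, charpoly_monic _, ha⟩
  have hcoeff : (X : Matrix ι ι F).charpoly.coeff 0 ≠ 0 := fun h ↦ by
    have := det_eq_sign_charpoly_coeff (X : Matrix ι ι F)
    simp [h] at this
  have ha0 : a ≠ 0 := by
    rintro rfl
    rw [aeval_def, eval₂_at_zero, map_eq_zero] at ha
    exact hcoeff ha
  have hdvd := minpoly.dvd F a ha
  have hle : (minpoly F a).natDegree ≤ Fintype.card ι := by
    rw [← charpoly_natDegree_eq_dim (X : Matrix ι ι F)]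
    exact natDegree_le_of_dvd hdvd (charpoly_monic _).ne_zero
  let L := IntermediateField.adjoin F {a}
  have hfin : FiniteDimensional F L := IntermediateField.adjoin.finiteDimensional hint
  have hfinrank : Module.finrank F L = (minpoly F a).natDegree :=
    IntermediateField.adjoin.finrank hint
  have : Finite L := Module.finite_of_finite F
  let g : L := IntermediateField.AdjoinSimple.gen F a
  have hg : (g : K) = a := IntermediateField.AdjoinSimple.coe_gen F a
  rcases hle.lt_or_eq with hlt | heq
  · refine .inl ⟨_, minpoly.natDegree_pos hint, hlt, ?_⟩
    have hcard : Nat.card L = Nat.card F ^ (minpoly F a).natDegree := by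
      rw [Module.natCard_eq_pow_finrank (K := F), hfinrank]
    rw [← hcard, ← hg]
    have := Fintype.ofFinite L
    have hg0 : g ≠ 0 := fun h ↦ ha0 (by rw [← hg, h]; rfl)
    have h1 := FiniteField.pow_card_sub_one_eq_one g hg0
    rw [← Nat.card_eq_fintype_card] at h1
    exact congrArg (algebraMap L K) h1
  -- In full degree the characteristic polynomial is minimal, so the norm of `a` is the determinant.
  · right
    have hchar : (X : Matrix ι ι F).charpoly = minpoly F a := by
      refine (eq_of_monic_of_dvd_of_natDegree_le (minpoly.monic hint) (charpoly_monic _) hdvd ?_)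
      rw [heq, charpoly_natDegree_eq_dim]
    have hnorm : Algebra.norm F g = 1 := by
      have h1 := Algebra.PowerBasis.norm_gen_eq_coeff_zero_minpoly
        (IntermediateField.adjoin.powerBasis hint)
      rw [IntermediateField.adjoin.powerBasis_gen, IntermediateField.adjoin.powerBasis_dim,
        IntermediateField.minpoly_gen, heq, ← hchar, ← det_eq_sign_charpoly_coeff,
        det_coe] at h1
      exact h1
    have h2 := FiniteField.algebraMap_norm_eq_pow_sum (K := F) (L := L) g
    rw [hnorm, map_one, hfinrank, heq] at h2
    have h3 := congrArg (algebraMap L K) h2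
    rw [map_one, map_pow] at h3
    rw [← hg]
    exact h3.symm

/-- If a power product is a scalar matrix, the eigenvalues of the factors are linked by the
scalar. -/
theorem exists_eigenvalues_of_pow_mul_pow_eq_scalar [IsAlgClosed K] {ι : Type*} [Fintype ι]
    [DecidableEq ι] [Nonempty ι] {X Y : SpecialLinearGroup ι F} {r : ℕ} (hr : 0 < r) {ζ : F}
    (hζ : ζ ≠ 0) (h : (↑(X ^ r * Y ^ r) : Matrix ι ι F) = scalar ι ζ) :
    ∃ a b : K, aeval a (X : Matrix ι ι F).charpoly = 0 ∧
      aeval b (↑(Y⁻¹) : Matrix ι ι F).charpoly = 0 ∧ a ^ r = algebraMap F K ζ * b ^ r := by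
  let f : Matrix ι ι F →+* Matrix ι ι K := (algebraMap F K).mapMatrix
  have hroot (Z : SpecialLinearGroup ι F) (c : K) (hc : c ∈ spectrum K (f Z)) :
      aeval c (Z : Matrix ι ι F).charpoly = 0 := by
    rw [mem_spectrum_iff_isRoot_charpoly] at hc
    rw [aeval_def, ← eval_map, ← charpoly_map]
    exact hc
  have hXY : f X ^ r = algebraMap F K ζ • f (↑(Y⁻¹)) ^ r := by
    have h1 : X ^ r = (X ^ r * Y ^ r) * Y⁻¹ ^ r := by simp [mul_assoc]
    have h2 := congrArg (fun Z : SpecialLinearGroup ι F ↦ f Z) h1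
    simp only [coe_mul (X ^ r * Y ^ r), h, map_mul, coe_pow, map_pow] at h2
    rw [h2]
    ext i j
    simp [f, RingHom.mapMatrix_apply, diagonal_map]
  obtain ⟨b, hb⟩ := spectrum.nonempty_of_isAlgClosed_of_finiteDimensional K (f (↑(Y⁻¹)))
  have hζ' : algebraMap F K ζ ≠ 0 := by simpa using hζ
  have hbr : algebraMap F K ζ * b ^ r ∈ spectrum K (f X ^ r) := by
    rw [hXY]
    have := spectrum.unit_smul_eq_smul (f (↑(Y⁻¹)) ^ r) (Units.mk0 _ hζ')
    rw [Units.smul_mk0] at this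
    rw [this]
    exact ⟨b ^ r, spectrum.pow_mem_pow _ _ hb, rfl⟩
  -- Spectral mapping: every eigenvalue of `X ^ r` is an `r`-th power of one of `X`.
  rw [spectrum.map_pow_of_pos _ hr] at hbr
  obtain ⟨a, ha, hab⟩ := hbr
  exact ⟨a, b, hroot _ _ ha, hroot _ _ hb, hab⟩

end Eigenvalues

end Matrix.SpecialLinearGroup


/-- The arithmetic of eigenvalues linked by `a ^ r = ζ * b ^ r` when every `r`-th root of `ζ ^ ±1`
has order `M`. -/
theorem false_of_pow_eq_mul_pow {K : Type*} [Field K] {q n r M N : ℕ} {ζ a b : K}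
    (hn : 1 < n) (hab : a ^ r = ζ * b ^ r)
    (hζ : ζ ^ (q - 1) = 1) (hr : r ∣ N)
    (hord : ∀ c : K, c ^ r = ζ → orderOf c = M) (hord' : ∀ c : K, c ^ r = ζ⁻¹ → orderOf c = M)
    (hMN : ¬ M ∣ N)
    (hMd : ∀ d d', 0 < d → d < n → 0 < d' → d' < n → ¬ M ∣ q ^ (d * d') - 1)
    (hcop : ∀ d, 0 < d → d < n → Nat.Coprime (N / r) (q ^ d - 1))
    (ha : (∃ d, 0 < d ∧ d < n ∧ a ^ (q ^ d - 1) = 1) ∨ a ^ N = 1)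
    (hb : (∃ d, 0 < d ∧ d < n ∧ b ^ (q ^ d - 1) = 1) ∨ b ^ N = 1) (hb0 : b ≠ 0) : False := by
  have hlift {c : K} {d e : ℕ} (h : c ^ (q ^ d - 1) = 1) : c ^ (q ^ (d * e) - 1) = 1 := by
    obtain ⟨k, hk⟩ : q ^ d - 1 ∣ q ^ (d * e) - 1 := by
      rw [pow_mul]; simpa using Nat.sub_dvd_pow_sub_pow (q ^ d) 1 e
    rw [hk, pow_mul, h, one_pow]
  have hζd (d : ℕ) : ζ ^ (q ^ d - 1) = 1 := by
    simpa using hlift (d := 1) (e := d) (by simpa using hζ)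
  have hMd1 {c : K} (hc : orderOf c = M) {d : ℕ} (h0 : 0 < d) (h1 : d < n)
      (h : c ^ (q ^ d - 1) = 1) : False := by
    refine hMd d 1 h0 h1 one_pos hn ?_
    rw [← hc, mul_one]
    exact orderOf_dvd_of_pow_eq_one h
  have hquot : orderOf (a / b) = M := hord _ (by rw [div_pow, hab]; field_simp)
  -- Mixed case: one eigenvalue has norm one, and its `r`-th power is also killed by `q ^ d - 1`;
  -- coprimality makes that power trivial, so the other eigenvalue is itself a root of `ζ` or `ζ⁻¹`.
  have hone {c : K} {d : ℕ} (h0 : 0 < d) (h1 : d < n) (h : c ^ N = 1)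
      (h' : (c ^ r) ^ (q ^ d - 1) = 1) : c ^ r = 1 := by
    have h2 : (c ^ r) ^ (N / r) = 1 := by rw [← pow_mul, Nat.mul_div_cancel' hr, h]
    rw [← orderOf_eq_one_iff]
    exact Nat.eq_one_of_dvd_coprimes (hcop d h0 h1) (orderOf_dvd_of_pow_eq_one h2)
      (orderOf_dvd_of_pow_eq_one h')
  rcases ha with ⟨d, hd0, hdn, ha⟩ | ha <;> rcases hb with ⟨d', hd0', hdn', hb⟩ | hb
  · refine hMd d d' hd0 hdn hd0' hdn' (hquot ▸ orderOf_dvd_of_pow_eq_one ?_)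
    rw [div_pow, hlift ha, mul_comm, hlift hb, div_one]
  · have hζ0 : ζ ≠ 0 := by
      rintro rfl
      have := hζd d
      rcases Nat.eq_zero_or_pos (q ^ d - 1) with h | h
      -- The witness is just `0`, a root of `ζ⁻¹ = 0`; the vanishing exponent makes its power `1`.
      · exact hMd1 (hord' (a ^ 0 * 0) (by simp_all)) hd0 hdn (by simp [h])
      · simp [h.ne'] at this
    have hb1 : b ^ r = 1 := by
      refine hone hd0 hdn hb ?_
      have : b ^ r = ζ⁻¹ * a ^ r := by rw [hab]; field_simp
      rw [this, mul_pow, inv_pow, hζd, ← pow_mul, mul_comm r, pow_mul, ha]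
      simp
    exact hMd1 (hord a (by rw [hab, hb1, mul_one])) hd0 hdn ha
  · have ha1 : a ^ r = 1 := by
      refine hone hd0' hdn' ha ?_
      rw [hab, mul_pow, hζd, ← pow_mul, mul_comm r, pow_mul, hb]
      simp
    exact hMd1 (hord' b (eq_inv_of_mul_eq_one_right (by rw [← hab, ha1]))) hd0' hdn' hb
  · exact hMN (hquot ▸ orderOf_dvd_of_pow_eq_one (by rw [div_pow, ha, hb, div_one]))

/-- A criterion for a scalar matrix to be outside the image of the power word map. -/
theorem not_surjective_powerWordMap {F : Type*} [Field F] [Finite F] {m n r M : ℕ} {ζ : F}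
    (hn : 1 < n) (hr0 : 0 < r) (hrm : r ∣ m) (hζn : ζ ^ n = 1)
    (hr : r ∣ ∑ i ∈ Finset.range n, Nat.card F ^ i)
    (hord : ∀ c : AlgebraicClosure F, c ^ r = algebraMap F _ ζ → orderOf c = M)
    (hord' : ∀ c : AlgebraicClosure F, c ^ r = (algebraMap F _ ζ)⁻¹ → orderOf c = M)
    (hMN : ¬ M ∣ ∑ i ∈ Finset.range n, Nat.card F ^ i)
    (hMd : ∀ d d', 0 < d → d < n → 0 < d' → d' < n → ¬ M ∣ Nat.card F ^ (d * d') - 1)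
    (hcop : ∀ d, 0 < d → d < n →
      Nat.Coprime ((∑ i ∈ Finset.range n, Nat.card F ^ i) / r) (Nat.card F ^ d - 1)) :
    ¬ Function.Surjective (powerWordMap (SpecialLinearGroup (Fin n) F) m) := by
  intro hsurj
  have hζ0 : ζ ≠ 0 := by rintro rfl; simp [show n ≠ 0 by omega] at hζn
  obtain ⟨⟨x, y⟩, hxy⟩ := hsurj ⟨scalar (Fin n) ζ, by simp [hζn]⟩
  obtain ⟨k, rfl⟩ := hrm
  have hxy' : (↑((x ^ k) ^ r * (y ^ k) ^ r) : Matrix (Fin n) (Fin n) F) = scalar (Fin n) ζ := by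
    rw [← pow_mul, ← pow_mul, mul_comm k r]
    exact congrArg Subtype.val hxy
  have : Nonempty (Fin n) := ⟨⟨0, by omega⟩⟩
  obtain ⟨a, b, ha, hb, hab⟩ := exists_eigenvalues_of_pow_mul_pow_eq_scalar
    (K := AlgebraicClosure F) hr0 hζ0 hxy'
  have hq := Nat.card_pos (α := F)
  have hN0 : ∑ i ∈ Finset.range n, Nat.card F ^ i ≠ 0 :=
    fun h ↦ hMN (h ▸ dvd_zero _)
  have ha' := pow_eq_one_of_isRoot_charpoly (x ^ k) ha
  have hb' := pow_eq_one_of_isRoot_charpoly (y ^ k)⁻¹ hb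
  rw [Fintype.card_fin] at ha' hb'
  have hq1 : 1 < Nat.card F := Finite.one_lt_card
  have hb0 : b ≠ 0 := by
    rintro rfl
    rcases hb' with ⟨d, hd, -, h⟩ | h
    · have : 1 < Nat.card F ^ d := Nat.one_lt_pow hd.ne' hq1
      rw [zero_pow (by omega)] at h
      exact zero_ne_one h
    · rw [zero_pow hN0] at h
      exact zero_ne_one h
  have hζq : algebraMap F (AlgebraicClosure F) ζ ^ (Nat.card F - 1) = 1 := by
    have := Fintype.ofFinite F
    rw [← map_pow, Nat.card_eq_fintype_card, FiniteField.pow_card_sub_one_eq_one ζ hζ0, map_one]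
  exact false_of_pow_eq_mul_pow hn hab hζq hr hord hord' hMN hMd hcop ha' hb' hb0

/-! ### Arithmetic of `q ≡ p + 1` modulo `p ^ 2`. -/

theorem pow_modEq_one_add_mul {p q : ℕ} (h : q ≡ p + 1 [MOD p ^ 2]) (k : ℕ) :
    q ^ k ≡ 1 + k * p [MOD p ^ 2] := by
  induction k with
  | zero => simp [Nat.ModEq.refl]
  | succ k ih =>
    rw [pow_succ]
    refine (ih.mul h).trans ?_
    have : (1 + k * p) * (p + 1) = 1 + (k + 1) * p + p ^ 2 * k := by ring
    rw [this]
    exact Nat.modEq_iff_dvd' (by omega) |>.2 (by simp) |>.symm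

/-- The linear terms add up to `p * (p * (p - 1) / 2)`, a multiple of `p ^ 2` because `p` is odd. -/
theorem geom_sum_modEq_self {p q : ℕ} (hp : Odd p) (h : q ≡ p + 1 [MOD p ^ 2]) :
    ∑ i ∈ Finset.range p, q ^ i ≡ p [MOD p ^ 2] := by
  have h1 : ∑ i ∈ Finset.range p, q ^ i ≡ ∑ i ∈ Finset.range p, (1 + i * p) [MOD p ^ 2] :=
    Nat.ModEq.sum fun i _ ↦ pow_modEq_one_add_mul h i
  refine h1.trans ?_
  obtain ⟨k, rfl⟩ := hp
  rw [Finset.sum_add_distrib, ← Finset.sum_mul, Finset.sum_range_id]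
  have : (2 * k + 1) * (2 * k + 1 - 1) / 2 = (2 * k + 1) * k := by
    rw [Nat.add_sub_cancel, show (2 * k + 1) * (2 * k) = ((2 * k + 1) * k) * 2 by ring]
    simp
  rw [this]
  simp only [Finset.sum_const, Finset.card_range, smul_eq_mul, mul_one]
  exact Nat.modEq_iff_dvd' (by omega) |>.2 ⟨k, by rw [Nat.add_sub_cancel_left]; ring⟩ |>.symm

theorem sq_dvd_pow_sub_one_iff {p q : ℕ} (hp : 0 < p) (hq : 0 < q) (h : q ≡ p + 1 [MOD p ^ 2])
    (k : ℕ) : p ^ 2 ∣ q ^ k - 1 ↔ p ∣ k := by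
  have h1 := pow_modEq_one_add_mul h k
  rw [← Nat.modEq_iff_dvd' (Nat.one_le_pow _ _ hq)]
  have h2 : 1 ≡ q ^ k [MOD p ^ 2] ↔ 1 ≡ 1 + k * p [MOD p ^ 2] :=
    ⟨fun h ↦ h.trans h1, fun h ↦ h.trans h1.symm⟩
  rw [h2, Nat.modEq_iff_dvd' (by omega), Nat.add_sub_cancel_left, sq]
  exact Nat.mul_dvd_mul_iff_right hp

/-- A common divisor divides `q ^ gcd(p, d) - 1 = q - 1`, modulo which the sum is `p`. So it is `1`
or `p`, and `p` would force `p ^ 2` to divide the sum. -/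
theorem coprime_geom_sum_div {p q d : ℕ} (hp : p.Prime) (hodd : Odd p) (hq : 1 < q)
    (h : q ≡ p + 1 [MOD p ^ 2]) (hd0 : 0 < d) (hdp : d < p) :
    Nat.Coprime ((∑ i ∈ Finset.range p, q ^ i) / p) (q ^ d - 1) := by
  have hN := geom_sum_modEq_self hodd h
  have hpN : p ∣ ∑ i ∈ Finset.range p, q ^ i :=
    (hN.dvd_iff (dvd_pow_self p two_ne_zero)).2 dvd_rfl
  have hgeom : (∑ i ∈ Finset.range p, q ^ i) ∣ q ^ p - 1 := by
    obtain ⟨x, rfl⟩ := Nat.exists_eq_add_of_le' hq.le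
    exact ⟨x, by rw [← geom_sum_mul_add x p, Nat.add_sub_cancel]⟩
  obtain ⟨o, ho⟩ : ∃ o, o = Nat.gcd ((∑ i ∈ Finset.range p, q ^ i) / p) (q ^ d - 1) := ⟨_, rfl⟩
  rw [Nat.Coprime, ← ho]
  have ho1 : o ∣ (∑ i ∈ Finset.range p, q ^ i) / p := ho ▸ Nat.gcd_dvd_left _ _
  have ho2 : o ∣ q ^ d - 1 := ho ▸ Nat.gcd_dvd_right _ _
  have hoN := ho1.trans (Nat.div_dvd_of_dvd hpN)
  have hoq : o ∣ q - 1 := by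
    have := Nat.dvd_gcd (hoN.trans hgeom) ho2
    rwa [Nat.pow_sub_one_gcd_pow_sub_one,
      ((Nat.Prime.coprime_iff_not_dvd hp).2 (Nat.not_dvd_of_pos_of_lt hd0 hdp)).gcd_eq_one,
      pow_one] at this
  have hq1 : q ≡ 1 [MOD o] := ((Nat.modEq_iff_dvd' hq.le).2 hoq).symm
  have hNp : ∑ i ∈ Finset.range p, q ^ i ≡ p [MOD o] := by
    have : ∑ i ∈ Finset.range p, q ^ i ≡ ∑ i ∈ Finset.range p, 1 ^ i [MOD o] :=
      Nat.ModEq.sum fun i _ ↦ hq1.pow i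
    simpa using this
  rcases (Nat.dvd_prime hp).1 ((hNp.dvd_iff dvd_rfl).1 hoN) with h1 | h1
  · exact h1
  · exfalso
    rw [h1, Nat.dvd_div_iff_mul_dvd hpN, ← sq, hN.dvd_iff dvd_rfl] at ho1
    have := Nat.le_of_dvd hp.pos ho1
    nlinarith [hp.two_le]

theorem orderOf_eq_sq_of_pow {K : Type*} [Field K] {p : ℕ} (hp : p.Prime) {c ζ : K}
    (hζ : orderOf ζ = p) (hc : c ^ p = ζ) : orderOf c = p ^ 2 := by
  have := Fact.mk hp
  refine orderOf_eq_prime_pow (n := 1) ?_ ?_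
  · rw [pow_one, hc, ← orderOf_eq_one_iff, hζ]
    exact hp.ne_one
  · rw [pow_succ, pow_one, pow_mul, hc, ← hζ, pow_orderOf_eq_one]

/-! ### The two families. -/

theorem not_surjective_powerWordMap_SL_prime {p m : ℕ} (hp : p.Prime) (hodd : Odd p) (hpm : p ∣ m)
    {F : Type*} [Field F] [Finite F] (hF : Nat.card F ≡ p + 1 [MOD p ^ 2]) :
    ¬ Function.Surjective (powerWordMap (SpecialLinearGroup (Fin p) F) m) := by
  have := Fact.mk hp
  have hq1 : 1 < Nat.card F := Finite.one_lt_card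
  have hdvd : p ∣ Nat.card Fˣ := by
    rw [Nat.card_units, ← Nat.modEq_iff_dvd' hq1.le]
    have := hF.of_dvd (dvd_pow_self p two_ne_zero)
    exact (this.trans (by simp [Nat.ModEq])).symm
  obtain ⟨u, hu⟩ := exists_prime_orderOf_dvd_card' p hdvd
  let f := (algebraMap F (AlgebraicClosure F))
  have hf (v : Fˣ) : orderOf (f (v : F)) = orderOf v :=
    (orderOf_injective f.toMonoidHom f.injective (v : F)).trans orderOf_units
  have hζ : orderOf (f (u : F)) = p := (hf u).trans hu
  have hζ' : orderOf (f (u : F))⁻¹ = p := by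
    rw [← map_inv₀, ← Units.val_inv_eq_inv_val, hf, orderOf_inv, hu]
  have hN := geom_sum_modEq_self hodd hF
  refine not_surjective_powerWordMap (r := p) (M := p ^ 2) (ζ := (u : F)) hp.one_lt hp.pos hpm ?_
    ((hN.dvd_iff (dvd_pow_self p two_ne_zero)).2 dvd_rfl)
    (fun c hc ↦ orderOf_eq_sq_of_pow hp hζ hc) (fun c hc ↦ orderOf_eq_sq_of_pow hp hζ' hc) ?_ ?_
    (fun d hd0 hdp ↦ coprime_geom_sum_div hp hodd hq1 hF hd0 hdp)
  · rw [← Units.val_pow_eq_pow_val, ← hu, pow_orderOf_eq_one, Units.val_one]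
  · rw [hN.dvd_iff dvd_rfl]
    intro h
    have := Nat.le_of_dvd hp.pos h
    nlinarith [hp.two_le]
  · intro d d' hd0 hd hd0' hd'
    rw [sq_dvd_pow_sub_one_iff hp.pos (by omega) hF, hp.dvd_mul]
    rintro (h | h)
    · exact Nat.not_dvd_of_pos_of_lt hd0 hd h
    · exact Nat.not_dvd_of_pos_of_lt hd0' hd' h

/-- Fourth roots of `-1` have order `8`, while `q + 1 ≡ 4` and `q - 1 ≡ 2` modulo `8`; hence `(q +
1) / 4` is odd and coprime to `q - 1`. -/
theorem not_surjective_powerWordMap_SL_two {m : ℕ} (hm : 4 ∣ m)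
    {F : Type*} [Field F] [Finite F] (hF : Nat.card F ≡ 3 [MOD 8]) :
    ¬ Function.Surjective (powerWordMap (SpecialLinearGroup (Fin 2) F) m) := by
  have hF' : Nat.card F % 8 = 3 := hF
  have hchar : (-1 : AlgebraicClosure F) ≠ 1 := by
    have : ringChar F ≠ 2 := fun h ↦ by
      have := Fintype.ofFinite F
      have := FiniteField.even_card_of_char_two h
      rw [← Nat.card_eq_fintype_card] at this
      omega
    have h1 := Ring.neg_one_ne_one_of_char_ne_two this
    intro h
    refine h1 ((algebraMap F (AlgebraicClosure F)).injective ?_)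
    simpa using h
  have hord (c : AlgebraicClosure F) (hc : c ^ 4 = -1) : orderOf c = 8 := by
    refine orderOf_eq_prime_pow (p := 2) (n := 2) ?_ ?_
    · norm_num [hc, hchar]
    · norm_num
      rw [show 8 = 4 * 2 by norm_num, pow_mul, hc]
      norm_num
  have hsum : ∑ i ∈ Finset.range 2, Nat.card F ^ i = 1 + Nat.card F := by
    simp [Finset.sum_range_succ]
  refine not_surjective_powerWordMap (r := 4) (M := 8) (ζ := (-1 : F)) (by norm_num) (by norm_num)
    hm (by norm_num) ?_ (fun c hc ↦ hord c (by simpa using hc))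
    (fun c hc ↦ hord c (by simpa [inv_neg] using hc)) ?_ ?_ ?_
  · omega
  · omega
  · intro d d' hd0 hd hd0' hd'
    obtain rfl : d = 1 := by omega
    obtain rfl : d' = 1 := by omega
    rw [mul_one, pow_one]
    omega
  · intro d hd0 hd
    obtain rfl : d = 1 := by omega
    rw [hsum, pow_one]
    have h1 : Nat.gcd ((1 + Nat.card F) / 4) (Nat.card F - 1) ∣ 2 := by
      have h2 : Nat.gcd ((1 + Nat.card F) / 4) (Nat.card F - 1) ∣ 1 + Nat.card F :=
        (Nat.gcd_dvd_left _ _).trans (Nat.div_dvd_of_dvd (by omega))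
      have h3 := Nat.dvd_sub h2 (Nat.gcd_dvd_right ((1 + Nat.card F) / 4) (Nat.card F - 1))
      rwa [show 1 + Nat.card F - (Nat.card F - 1) = 2 by omega] at h3
    rcases (Nat.dvd_prime Nat.prime_two).1 h1 with h2 | h2
    · exact h2
    · have h3 := Nat.gcd_dvd_left ((1 + Nat.card F) / 4) (Nat.card F - 1)
      rw [h2] at h3
      omega

theorem isQuasisimpleGroup_SL_of_two_lt {n : ℕ} (hn : 2 < n) (F : Type*) [Field F] :
    IsQuasisimpleGroup (SpecialLinearGroup (Fin n) F) := by
  have : Nontrivial (Fin n) := Fin.nontrivial_iff_two_le.2 hn.le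
  have hperf : Group.IsPerfect (SpecialLinearGroup (Fin n) F) :=
    isPerfect_of_two_lt_card (by simpa using hn)
  exact ⟨hperf, ProjectiveSpecialLinearGroup.isSimpleGroup_of_isPerfect hperf⟩

theorem isQuasisimpleGroup_SL_two (F : Type*) [Field F] [Finite F] (hF : 3 < Nat.card F) :
    IsQuasisimpleGroup (SpecialLinearGroup (Fin 2) F) := by
  -- Perfectness in rank two needs a unit with `u ^ 2 ≠ 1`; a generator has order `q - 1 > 2`.
  obtain ⟨u, hu⟩ := IsCyclic.exists_ofOrder_eq_natCard (α := Fˣ)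
  rw [Nat.card_units] at hu
  have hsq : (u : F) ^ 2 ≠ 1 := fun h ↦ by
    have := orderOf_le_of_pow_eq_one two_pos (Units.ext (by simpa using h) : u ^ 2 = 1)
    omega
  exact ⟨⟨SL2.commutator_eq_top u.ne_zero hsq⟩,
    ProjectiveSpecialLinearGroup.rank_two_simple (by omega)⟩

theorem card_le_card_SL {n : ℕ} (hn : 1 < n) (F : Type*) [Field F] [Finite F] :
    Nat.card F ≤ Nat.card (SpecialLinearGroup (Fin n) F) := by
  have hij : (⟨0, by omega⟩ : Fin n) ≠ ⟨1, hn⟩ := by simp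
  refine Nat.card_le_card_of_injective (transvection hij) fun a b hab ↦ ?_
  have := congrArg (fun A : SpecialLinearGroup (Fin n) F ↦ A ⟨0, by omega⟩ ⟨1, hn⟩) hab
  simpa [transvection_coe] using this

/-! ### Dirichlet's theorem and assembly. -/

theorem infinite_primes_modEq_add_one_sq {p : ℕ} (hp : p.Prime) :
    {q : ℕ | q.Prime ∧ q ≡ p + 1 [MOD p ^ 2]}.Infinite :=
  Nat.infinite_setOfPred_prime_and_modEq (pow_ne_zero 2 hp.ne_zero) (by simp)

theorem infinite_primes_modEq_three_eight : {q : ℕ | q.Prime ∧ q ≡ 3 [MOD 8]}.Infinite :=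
  Nat.infinite_setOfPred_prime_and_modEq (by norm_num) (by norm_num)

theorem corollary4p3 (n : ℕ) (hn : 2 < n) :
    -- quasisimple groups of arbitrarily large order on which `x ^ n * y ^ n` is not surjective
    (∀ N : ℕ, ∃ (G : Type) (_ : Group G),
      Finite G ∧ IsQuasisimpleGroup G ∧ N < Nat.card G ∧
        ¬ Function.Surjective (powerWordMap G n)) ∧
    -- the examples `SL_p(q)` for an odd prime `p` dividing `n`
    (∀ p : ℕ, p.Prime → Odd p → p ∣ n →
      {q : ℕ | q.Prime ∧ q ≡ p + 1 [MOD p ^ 2]}.Infinite ∧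
      ∀ (F : Type) [Field F] [Finite F], Nat.card F ≡ p + 1 [MOD p ^ 2] →
        IsQuasisimpleGroup (Matrix.SpecialLinearGroup (Fin p) F) ∧
          ¬ Function.Surjective (powerWordMap (Matrix.SpecialLinearGroup (Fin p) F) n)) ∧
    -- the examples `SL_2(q)` when `4` divides `n`
    (4 ∣ n →
      {q : ℕ | q.Prime ∧ q ≡ 3 [MOD 8]}.Infinite ∧
      ∀ (F : Type) [Field F] [Finite F], Nat.card F ≡ 3 [MOD 8] → 3 < Nat.card F →
        IsQuasisimpleGroup (Matrix.SpecialLinearGroup (Fin 2) F) ∧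
          ¬ Function.Surjective (powerWordMap (Matrix.SpecialLinearGroup (Fin 2) F) n)) := by
  have hodd (p : ℕ) (hp : p.Prime) (hpo : Odd p) (hpn : p ∣ n) (F : Type) [Field F] [Finite F]
      (hF : Nat.card F ≡ p + 1 [MOD p ^ 2]) :
      IsQuasisimpleGroup (SpecialLinearGroup (Fin p) F) ∧
        ¬ Function.Surjective (powerWordMap (SpecialLinearGroup (Fin p) F) n) := by
    refine ⟨isQuasisimpleGroup_SL_of_two_lt (lt_of_le_of_ne hp.two_le ?_) F,
      not_surjective_powerWordMap_SL_prime hp hpo hpn hF⟩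
    rintro rfl
    exact absurd hpo (by decide)
  have htwo (h4 : 4 ∣ n) (F : Type) [Field F] [Finite F] (hF : Nat.card F ≡ 3 [MOD 8])
      (hF3 : 3 < Nat.card F) :
      IsQuasisimpleGroup (SpecialLinearGroup (Fin 2) F) ∧
        ¬ Function.Surjective (powerWordMap (SpecialLinearGroup (Fin 2) F) n) :=
    ⟨isQuasisimpleGroup_SL_two F hF3, not_surjective_powerWordMap_SL_two h4 hF⟩
  refine ⟨fun N ↦ ?_, fun p hp hpo hpn ↦ ⟨infinite_primes_modEq_add_one_sq hp, hodd p hp hpo hpn⟩,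
    fun h4 ↦ ⟨infinite_primes_modEq_three_eight, htwo h4⟩⟩
  by_cases h4 : 4 ∣ n
  · obtain ⟨q, ⟨hq, hq8⟩, hqN⟩ := infinite_primes_modEq_three_eight.exists_gt (max N 3)
    have := Fact.mk hq
    have hle := card_le_card_SL one_lt_two (ZMod q)
    rw [max_lt_iff] at hqN
    obtain ⟨h1, h2⟩ := htwo h4 (ZMod q) (by rwa [Nat.card_zmod]) (by rw [Nat.card_zmod]; omega)
    rw [Nat.card_zmod] at hle
    exact ⟨SpecialLinearGroup (Fin 2) (ZMod q), inferInstance, inferInstance, h1, by omega, h2⟩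
  -- A power of two that exceeds `2` is divisible by `4`.
  · obtain ⟨p, hp, hpn, hpo⟩ : ∃ p, p.Prime ∧ p ∣ n ∧ Odd p := by
      rcases n.eq_two_pow_or_exists_odd_prime_and_dvd with ⟨k, rfl⟩ | h
      · refine absurd (pow_dvd_pow 2 (?_ : 2 ≤ k)) h4
        by_contra! hk
        interval_cases k <;> omega
      · exact h
    obtain ⟨q, ⟨hq, hqp⟩, hqN⟩ := (infinite_primes_modEq_add_one_sq hp).exists_gt N
    have := Fact.mk hq
    have hle := card_le_card_SL hp.one_lt (ZMod q)
    obtain ⟨h1, h2⟩ := hodd p hp hpo hpn (ZMod q) (by rwa [Nat.card_zmod])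
    rw [Nat.card_zmod] at hle
    exact ⟨SpecialLinearGroup (Fin p) (ZMod q), inferInstance, inferInstance, h1, by omega, h2⟩
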